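/- Let $S_\infty$ be the group of all permutations of $\mathbb{N}$ with the topology of pointwise convergence, let $G\le S_\infty$ be a closed subgroup, and let $X$ be a Polish space with a continuous action of $G$ and a countable basis $\{A_l : l\in\mathbb{N}\}$ of open sets. Let $S^G_{<\infty}$ be the set of all restrictions $f|_d$ with $f\in G$ and $d\subset\mathbb{N}$ finite. For $\sigma\in S^G_{<\infty}$ put $V^G_\sigma=\{f\in G : f\supseteq\sigma\}$, and for a finite $c\subset\mathbb{N}$ put $V^G_c=\{f\in G : f(k)=k \text{ for all } k\in c\}$. For $x\in X$, $\sigma\in S^G_{<\infty}$ with domain $d$ and range $c$, and ordinals $\alpha\ge 1$, define the $\alpha$-sets $B_\alpha(x,\sigma)\subseteq X$ by recursion: $$B_1(x,\sigma)=\bigcap\{V^G_cA_l : V^G_\sigma x\cap A_l\neq\emptyset\}\cap\bigcap\{X\setminus V^G_cA_l : V^G_\sigma x\cap A_l=\emptyset\},$$ $$B_{\alpha+1}(x,\sigma)=\bigcap_{b\supseteq d}\ \bigcup\{B_\alpha(x,\sigma') : \sigma'\in S^G_{<\infty},\ \sigma'\supseteq\sigma,\ \mathrm{dom}\,\sigma'=b\}\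 \cap\ \bigcap_{a\supseteq c}\ \bigcup\{B_\alpha(x,\sigma') : \sigma'\in S^G_{<\infty},\ \sigma'\supseteq\sigma,\ \mathrm{rng}\,\sigma'=a\},$$ where $a,b$ range over finite subsets of $\mathbb{N}$, and $B_\lambda(x,\sigma)=\bigcap_{1\le\alpha<\lambda}B_\alpha(x,\sigma)$ for limit $\lambda$. For every $x\in X$ there is a least countable ordinal $\gamma\ge 1$ with the following property: for all $\sigma,\delta\in S^G_{<\infty}$ with the same range, if $B_\alpha(x,\sigma)\neq B_\alpha(x,\delta)$ for some $\alpha$ with $1\le\alpha<\omega_1$, then $B_\gamma(x,\sigma)\neq B_\gamma(x,\delta)$. Denote it by $\gamma^G_\star(x)$. Then $$B_{\gamma^G_\star(x)+2}(x,\emptyset)=Gx,$$ and, more generally, $B_{\gamma^G_\star(x)+2}(x,\sigma)=V^G_\sigma x$ for every $\sigma\in S^G_{<\infty}$. -/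

import Mathlib

open scoped Pointwise Ordinal

noncomputable section

namespace AlphaSets

/-- The standard topology of the group `S_∞` of all permutations of the natural numbers: the
topology of pointwise convergence, i.e. the one induced from the product topology on `ℕ → ℕ`. -/
instance permTopology : TopologicalSpace (Equiv.Perm ℕ) :=
  TopologicalSpace.induced (fun (f : Equiv.Perm ℕ) (n : ℕ) => f n) inferInstance

/-- `S^G_{<∞}`: the restrictions of elements of `G` to finite sets of natural numbers.
A finite partial map is identified with its graph. -/
def FinPart (G : Subgroup (Equiv.Perm ℕ)) : Type :=
  {σ : Finset (ℕ × ℕ) //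
    ∃ f ∈ G, ∃ d : Finset ℕ, σ = d.image (fun k => (k, (f : Equiv.Perm ℕ) k))}

namespace FinPart

variable {G : Subgroup (Equiv.Perm ℕ)}

/-- The domain of a finite partial map. -/
def dom (σ : FinPart G) : Finset ℕ := σ.1.image Prod.fst

/-- The range of a finite partial map. -/
def rng (σ : FinPart G) : Finset ℕ := σ.1.image Prod.snd

/-- `σ.Ext τ` says that `τ` extends `σ`, i.e. `σ ⊆ τ`. -/
def Ext (σ τ : FinPart G) : Prop := σ.1 ⊆ τ.1

/-- The empty map. -/
def empty (G : Subgroup (Equiv.Perm ℕ)) : FinPart G :=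
  ⟨∅, 1, G.one_mem, ∅, by simp⟩

end FinPart

/-- `V^G_σ`, the set of all `f ∈ G` with `f ⊇ σ`. -/
def V (G : Subgroup (Equiv.Perm ℕ)) (σ : FinPart G) : Set G :=
  {f | ∀ p ∈ σ.1, (f : Equiv.Perm ℕ) p.1 = p.2}

/-- `V^G_c`, the pointwise stabilizer in `G` of the finite set `c`. -/
def stab (G : Subgroup (Equiv.Perm ℕ)) (c : Finset ℕ) : Set G :=
  {f | ∀ k ∈ c, (f : Equiv.Perm ℕ) k = k}

variable {X : Type*}

/-- `V^G_σ x`, the set of all `f x` with `f ∈ V^G_σ`. -/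
def partialOrbit (G : Subgroup (Equiv.Perm ℕ)) [MulAction G X] (x : X) (σ : FinPart G) : Set X :=
  (fun f : G => f • x) '' V G σ

/-- The first level `B_1(x, σ)`. -/
def baseSet (G : Subgroup (Equiv.Perm ℕ)) [MulAction G X] (A : ℕ → Set X) (x : X)
    (σ : FinPart G) : Set X :=
  (⋂ (l : ℕ) (_ : (partialOrbit G x σ ∩ A l).Nonempty), stab G σ.rng • A l) ∩
    ⋂ (l : ℕ) (_ : partialOrbit G x σ ∩ A l = ∅), (stab G σ.rng • A l)ᶜ

/-- The passage from the sets `B_α(x, ·)` to the sets `B_{α+1}(x, ·)`. -/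
def stepSet (G : Subgroup (Equiv.Perm ℕ)) (B : FinPart G → Set X) (σ : FinPart G) : Set X :=
  (⋂ (b : Finset ℕ) (_ : σ.dom ⊆ b), ⋃ (τ : FinPart G) (_ : σ.Ext τ ∧ τ.dom = b), B τ) ∩
    ⋂ (a : Finset ℕ) (_ : σ.rng ⊆ a), ⋃ (τ : FinPart G) (_ : σ.Ext τ ∧ τ.rng = a), B τ

open Classical in
/-- The `α`-set `B_α(x, σ)`, for an ordinal `α > 0`. The value at `α = 0` is a dummy; the equations
of the recursion are the three lemmas that follow. -/
def alphaSet (G : Subgroup (Equiv.Perm ℕ)) [MulAction G X] (A : ℕ → Set X) (x : X)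
    (α : Ordinal.{0}) : FinPart G → Set X :=
  Ordinal.limitRecOn α (fun _ => Set.univ)
    (fun β B => if β = 0 then baseSet G A x else stepSet G B)
    (fun o _ B σ => ⋂ (β : Ordinal.{0}) (h : β < o) (_ : 0 < β), B β h σ)

theorem alphaSet_one (G : Subgroup (Equiv.Perm ℕ)) [MulAction G X] (A : ℕ → Set X) (x : X)
    (σ : FinPart G) : alphaSet G A x 1 σ = baseSet G A x σ := by
  have h := Ordinal.limitRecOn_add_one (motive := fun _ => FinPart G → Set X) 0
    (fun _ => Set.univ)
    (fun β B => open Classical in if β = 0 then baseSet G A x else stepSet G B)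
    (fun o _ B σ => ⋂ (β : Ordinal.{0}) (h : β < o) (_ : 0 < β), B β h σ)
  rw [zero_add, if_pos rfl] at h
  exact congrFun h σ

theorem alphaSet_add_one (G : Subgroup (Equiv.Perm ℕ)) [MulAction G X] (A : ℕ → Set X) (x : X)
    (α : Ordinal.{0}) (hα : 0 < α) (σ : FinPart G) :
    alphaSet G A x (α + 1) σ = stepSet G (alphaSet G A x α) σ := by
  have h := Ordinal.limitRecOn_add_one (motive := fun _ => FinPart G → Set X) α
    (fun _ => Set.univ)
    (fun β B => open Classical in if β = 0 then baseSet G A x else stepSet G B)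
    (fun o _ B σ => ⋂ (β : Ordinal.{0}) (h : β < o) (_ : 0 < β), B β h σ)
  rw [if_neg hα.ne'] at h
  exact congrFun h σ

theorem alphaSet_limit (G : Subgroup (Equiv.Perm ℕ)) [MulAction G X] (A : ℕ → Set X) (x : X)
    (o : Ordinal.{0}) (ho : Order.IsSuccLimit o) (σ : FinPart G) :
    alphaSet G A x o σ = ⋂ (β : Ordinal.{0}) (_ : β < o) (_ : 0 < β), alphaSet G A x β σ :=
  congrFun (Ordinal.limitRecOn_limit (motive := fun _ => FinPart G → Set X) o
    (fun _ => Set.univ)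
    (fun β B => open Classical in if β = 0 then baseSet G A x else stepSet G B)
    (fun o _ B σ => ⋂ (β : Ordinal.{0}) (h : β < o) (_ : 0 < β), B β h σ) ho) σ

/-- The countable ordinals `γ > 0` such that any two sets `B_α(x, σ)`, `B_α(x, δ)` with
`rng σ = rng δ` which are distinct for some countable `α > 0` are already distinct for `α = γ`. -/
def separatingLevels (G : Subgroup (Equiv.Perm ℕ)) [MulAction G X] (A : ℕ → Set X) (x : X) :
    Set Ordinal.{0} :=
  {γ | 0 < γ ∧ γ < ω₁ ∧ ∀ σ δ : FinPart G, σ.rng = δ.rng →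
    (∃ α : Ordinal.{0}, 0 < α ∧ α < ω₁ ∧ alphaSet G A x α σ ≠ alphaSet G A x α δ) →
      alphaSet G A x γ σ ≠ alphaSet G A x γ δ}

/-- `γ^G_⋆(x)`, the least separating level. -/
def gammaStar (G : Subgroup (Equiv.Perm ℕ)) [MulAction G X] (A : ℕ → Set X) (x : X) :
    Ordinal.{0} :=
  sInf (separatingLevels G A x)

end AlphaSets

end

/-!
The sets `B_α(x, σ)` are the classes of a back-and-forth analysis of the point `x`, and the proof
is Scott's argument for countable structures, carried out with finite parts of elements of `G`.

The group `G` acts on everything in sight: `y ∈ B_α(x, σ)` implies `h y ∈ B_α(x, hσ)`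
(`smul_mem_alphaSet`). As two finite parts with the same domain differ by a translation, this makes
the sets `B_α(x, σ)` with a fixed range of `σ` pairwise equal or disjoint
(`alphaSet_subset_of_mem`). They are nonempty, since they contain `V_σ x`
(`partialOrbit_subset_alphaSet`), and decrease with `α`. Hence two of them, once different, remain
different at all later levels, and as there are only countably many finite parts, a countable level
`γ` separates all pairs that are ever separated (`separatingLevels_nonempty`).

Let `y ∈ B_{γ+2}(x, σ)`. If `τ ⊇ σ` and `y ∈ B_γ(x, τ)`, then `y ∈ B_{γ+1}(x, τ)`: there is some
`δ ⊇ σ` with the range of `τ` and `y ∈ B_{γ+1}(x, δ)`, so that `B_γ(x, τ) = B_γ(x, δ)` and, by the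
choice of `γ`, also `B_{γ+1}(x, τ) = B_{γ+1}(x, δ)` (`mem_alphaSet_add_one_of_mem`). So `σ` can be
extended step by step through finite parts `τ` with `y ∈ B_{γ+1}(x, τ)`, whose domains and ranges
exhaust `ℕ`. Their union is some `f ∈ G` because `G` is closed (`FinPart.exists_mem_V_of_chain`),
and `f x = y` because `y ∈ B_1(x, τ)` for all these `τ` and the sets `V_τ x` shrink to `f x`
(`smul_eq_of_chain`).
-/

open Filter Topology

namespace AlphaSets

variable {G : Subgroup (Equiv.Perm ℕ)}

/-! ### Finite parts of elements of the group -/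

namespace FinPart

theorem ext_iff {σ τ : FinPart G} : σ = τ ↔ σ.1 = τ.1 := Subtype.ext_iff

theorem Ext.refl (σ : FinPart G) : σ.Ext σ := Finset.Subset.refl _

theorem Ext.trans {ρ σ τ : FinPart G} (h : ρ.Ext σ) (h' : σ.Ext τ) : ρ.Ext τ :=
  Finset.Subset.trans h h'

theorem Ext.dom_subset {σ τ : FinPart G} (h : σ.Ext τ) : σ.dom ⊆ τ.dom :=
  Finset.image_subset_image h

theorem Ext.rng_subset {σ τ : FinPart G} (h : σ.Ext τ) : σ.rng ⊆ τ.rng :=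
  Finset.image_subset_image h

theorem mem_dom {σ : FinPart G} {k : ℕ} : k ∈ σ.dom ↔ ∃ m, (k, m) ∈ σ.1 := by
  simp [dom]

theorem mem_rng {σ : FinPart G} {m : ℕ} : m ∈ σ.rng ↔ ∃ k, (k, m) ∈ σ.1 := by
  simp [rng]

theorem V_anti {σ τ : FinPart G} (h : σ.Ext τ) : V G τ ⊆ V G σ :=
  fun _ hf p hp => hf p (h hp)

theorem V_nonempty (σ : FinPart G) : (V G σ).Nonempty := by
  obtain ⟨s, f, hf, d, rfl⟩ := σ
  refine ⟨⟨f, hf⟩, ?_⟩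
  rintro p hp
  obtain ⟨k, -, rfl⟩ := Finset.mem_image.1 hp
  rfl

theorem mem_iff_of_mem_V {σ : FinPart G} {f : G} (hf : f ∈ V G σ) {k m : ℕ} :
    (k, m) ∈ σ.1 ↔ k ∈ σ.dom ∧ (f : Equiv.Perm ℕ) k = m := by
  constructor
  · exact fun h => ⟨mem_dom.2 ⟨m, h⟩, hf _ h⟩
  · rintro ⟨h, rfl⟩
    obtain ⟨m, hm⟩ := mem_dom.1 h
    rwa [hf _ hm]

theorem ext_of_mem_V {σ τ : FinPart G} {f : G} (hσ : f ∈ V G σ) (hτ : f ∈ V G τ)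
    (h : σ.dom ⊆ τ.dom) : σ.Ext τ := by
  rintro ⟨k, m⟩ hp
  rw [mem_iff_of_mem_V hσ] at hp
  exact (mem_iff_of_mem_V hτ).2 ⟨h hp.1, hp.2⟩

theorem eq_of_mem_V {σ τ : FinPart G} {f : G} (hσ : f ∈ V G σ) (hτ : f ∈ V G τ)
    (h : σ.dom = τ.dom) : σ = τ :=
  ext_iff.2 (Finset.Subset.antisymm (ext_of_mem_V hσ hτ h.subset) (ext_of_mem_V hτ hσ h.superset))

theorem Ext.eq_of_dom_eq {σ τ : FinPart G} (h : σ.Ext τ) (hd : τ.dom = σ.dom) : τ = σ := by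
  obtain ⟨f, hf⟩ := V_nonempty τ
  exact eq_of_mem_V hf (V_anti h hf) hd

/-- The restriction of `f` to the finite set `d`. -/
def restrict (f : G) (d : Finset ℕ) : FinPart G :=
  ⟨d.image (fun k => (k, (f : Equiv.Perm ℕ) k)), f, f.2, d, rfl⟩

theorem dom_restrict (f : G) (d : Finset ℕ) : (restrict f d).dom = d := by
  ext k
  simp [dom, restrict, Finset.image_image, Function.comp_def]

theorem rng_restrict (f : G) (d : Finset ℕ) :
    (restrict f d).rng = d.image (f : Equiv.Perm ℕ) := by
  ext k
  simp [rng, restrict, Finset.image_image, Function.comp_def]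

theorem mem_V_restrict (f : G) (d : Finset ℕ) : f ∈ V G (restrict f d) := by
  intro p hp
  obtain ⟨k, -, rfl⟩ := Finset.mem_image.1 hp
  rfl

theorem rng_eq_image {σ : FinPart G} {f : G} (hf : f ∈ V G σ) :
    σ.rng = σ.dom.image (f : Equiv.Perm ℕ) := by
  rw [eq_of_mem_V hf (mem_V_restrict f σ.dom) (dom_restrict f σ.dom).symm, rng_restrict,
    dom_restrict]

/-- The composition `h ∘ σ`. -/
def translate (h : G) (σ : FinPart G) : FinPart G :=
  ⟨σ.1.image (fun p => (p.1, (h : Equiv.Perm ℕ) p.2)), by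
    obtain ⟨s, f, hf, d, rfl⟩ := σ
    exact ⟨h * f, G.mul_mem h.2 hf, d, by simp [Finset.image_image, Function.comp_def]⟩⟩

theorem dom_translate (h : G) (σ : FinPart G) : (translate h σ).dom = σ.dom := by
  simp [dom, translate, Finset.image_image, Function.comp_def]

theorem rng_translate (h : G) (σ : FinPart G) :
    (translate h σ).rng = σ.rng.image (h : Equiv.Perm ℕ) := by
  simp [rng, translate, Finset.image_image, Function.comp_def]

theorem Ext.translate {σ τ : FinPart G} (hστ : σ.Ext τ) (h : G) :
    (FinPart.translate h σ).Ext (FinPart.translate h τ) :=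
  Finset.image_subset_image hστ

theorem mul_mem_V_translate {f : G} {σ : FinPart G} (h : G) (hf : f ∈ V G σ) :
    h * f ∈ V G (translate h σ) := by
  intro p hp
  obtain ⟨q, hq, rfl⟩ := Finset.mem_image.1 hp
  simp [hf q hq]

theorem translate_inv_translate (h : G) (σ : FinPart G) :
    translate h⁻¹ (translate h σ) = σ := by
  rw [ext_iff]
  simp [translate, Finset.image_image, Function.comp_def]

theorem translate_eq_self {h : G} {σ : FinPart G} (hh : h ∈ stab G σ.rng) :
    translate h σ = σ := by
  rw [ext_iff]
  refine (Finset.image_congr fun p hp => ?_).trans Finset.image_id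
  exact Prod.ext rfl (hh p.2 (mem_rng.2 ⟨p.1, hp⟩))

/-- Two finite parts with the same domain differ by a translation, which fixes the range of every
common restriction. -/
theorem exists_translate_eq {σ τ : FinPart G} (hd : σ.dom = τ.dom) :
    ∃ h : G, translate h σ = τ ∧
      ∀ ρ : FinPart G, ρ.Ext σ → ρ.Ext τ → h ∈ stab G ρ.rng := by
  obtain ⟨f, hf⟩ := V_nonempty σ
  obtain ⟨g, hg⟩ := V_nonempty τ
  refine ⟨g * f⁻¹, ?_, ?_⟩
  · refine eq_of_mem_V (f := g) ?_ hg (by rw [dom_translate, hd])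
    simpa using mul_mem_V_translate (g * f⁻¹) hf
  · intro ρ hσ hτ m hm
    obtain ⟨k, hk⟩ := mem_rng.1 hm
    have h1 : (f : Equiv.Perm ℕ) k = m := hf _ (hσ hk)
    have h2 : (g : Equiv.Perm ℕ) k = m := hg _ (hτ hk)
    subst h1
    simpa using h2

instance : Countable (FinPart G) :=
  inferInstanceAs (Countable {_σ : Finset (ℕ × ℕ) // _})

/-! ### Chains of finite parts -/

theorem ext_of_le {s : ℕ → FinPart G} (hs : ∀ n, (s n).Ext (s (n + 1))) {m n : ℕ} (h : m ≤ n) :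
    (s m).Ext (s n) := by
  induction n, h using Nat.le_induction with
  | base => exact Ext.refl _
  | succ n _ ih => exact ih.trans (hs n)

theorem tendsto_perm_of_chain {s : ℕ → FinPart G} (hs : ∀ n, (s n).Ext (s (n + 1)))
    (hd : ∀ n, n ∈ (s (n + 1)).dom) {g : ℕ → G} (hg : ∀ n, g n ∈ V G (s n)) {f : Equiv.Perm ℕ}
    (hf : ∀ n, ∀ p ∈ (s n).1, f p.1 = p.2) :
    Tendsto (fun n => (g n : Equiv.Perm ℕ)) atTop (𝓝 f) := by
  have hind : IsInducing (fun (f : Equiv.Perm ℕ) (n : ℕ) => f n) := ⟨rfl⟩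
  rw [hind.tendsto_nhds_iff, tendsto_pi_nhds]
  intro k
  refine tendsto_const_nhds.congr' ?_
  filter_upwards [eventually_ge_atTop (k + 1)] with n hn
  obtain ⟨m, hm⟩ := mem_dom.1 (hd k)
  have h1 : (g n : Equiv.Perm ℕ) k = m := hg n _ (ext_of_le hs hn hm)
  have h2 : f k = m := hf _ _ hm
  simp [h1, h2]

/-- The union of a chain of finite parts whose domains and ranges exhaust `ℕ` belongs to the group
if the group is closed. -/
theorem exists_mem_V_of_chain (hG : IsClosed (G : Set (Equiv.Perm ℕ))) {s : ℕ → FinPart G}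
    (hs : ∀ n, (s n).Ext (s (n + 1))) (hd : ∀ n, n ∈ (s (n + 1)).dom)
    (hr : ∀ n, n ∈ (s (n + 1)).rng) : ∃ f : G, ∀ n, f ∈ V G (s n) := by
  choose g hg using fun n => V_nonempty (s n)
  choose u hu using fun n => mem_dom.1 (hd n)
  choose v hv using fun n => mem_rng.1 (hr n)
  have key : ∀ {i j k m m' : ℕ}, (k, m) ∈ (s i).1 → (k, m') ∈ (s j).1 → m = m' := by
    intro i j k m m' hi hj
    have h1 := hg (max i j) _ (ext_of_le hs (le_max_left i j) hi)
    have h2 := hg (max i j) _ (ext_of_le hs (le_max_right i j) hj)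
    exact h1.symm.trans h2
  have key' : ∀ {i j k k' m : ℕ}, (k, m) ∈ (s i).1 → (k', m) ∈ (s j).1 → k = k' := by
    intro i j k k' m hi hj
    have h1 := hg (max i j) _ (ext_of_le hs (le_max_left i j) hi)
    have h2 := hg (max i j) _ (ext_of_le hs (le_max_right i j) hj)
    exact (g (max i j) : Equiv.Perm ℕ).injective (h1.trans h2.symm)
  let f : Equiv.Perm ℕ :=
    { toFun := u
      invFun := v
      left_inv := fun k => key' (hv (u k)) (hu k)
      right_inv := fun k => key (hu (v k)) (hv k) }
  have hf : ∀ n, ∀ p ∈ (s n).1, f p.1 = p.2 := fun n p hp => key (hu p.1) hp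
  have hfG : f ∈ G :=
    hG.mem_of_tendsto (tendsto_perm_of_chain hs hd hg hf) (Eventually.of_forall fun n => (g n).2)
  exact ⟨⟨f, hfG⟩, hf⟩

end FinPart

open FinPart

/-! ### Stabilizers, partial orbits and the successor step -/

theorem one_mem_stab (c : Finset ℕ) : (1 : G) ∈ stab G c := fun _ _ => rfl

theorem inv_mem_stab {c : Finset ℕ} {g : G} (hg : g ∈ stab G c) : g⁻¹ ∈ stab G c := by
  intro k hk
  have := hg k hk
  rw [InvMemClass.coe_inv, Equiv.Perm.inv_eq_iff_eq, this]

theorem conj_mem_stab {c : Finset ℕ} {g : G} (h : G) (hg : g ∈ stab G c) :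
    h * g * h⁻¹ ∈ stab G (c.image (h : Equiv.Perm ℕ)) := by
  intro k hk
  obtain ⟨m, hm, rfl⟩ := Finset.mem_image.1 hk
  simp [hg m hm]

theorem mul_mem_V {σ : FinPart G} {f g : G} (hf : f ∈ V G σ) (hg : g ∈ stab G σ.rng) :
    g * f ∈ V G σ := by
  simpa [translate_eq_self hg] using mul_mem_V_translate g hf

theorem mul_inv_mem_stab {σ : FinPart G} {f g : G} (hf : f ∈ V G σ) (hg : g ∈ V G σ) :
    g * f⁻¹ ∈ stab G σ.rng := by
  intro m hm
  obtain ⟨k, hk⟩ := mem_rng.1 hm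
  have h1 : (f : Equiv.Perm ℕ) k = m := hf _ hk
  have h2 : (g : Equiv.Perm ℕ) k = m := hg _ hk
  subst h1
  simpa using h2

variable {X : Type*}

theorem mem_stepSet_iff {B : FinPart G → Set X} {σ : FinPart G} {y : X} :
    y ∈ stepSet G B σ ↔
      (∀ b, σ.dom ⊆ b → ∃ τ : FinPart G, σ.Ext τ ∧ τ.dom = b ∧ y ∈ B τ) ∧
      ∀ a, σ.rng ⊆ a → ∃ τ : FinPart G, σ.Ext τ ∧ τ.rng = a ∧ y ∈ B τ := by
  simp [stepSet, and_assoc]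

variable [MulAction G X]

theorem mem_stab_smul {c : Finset ℕ} {U : Set X} {y : X} :
    y ∈ stab G c • U ↔ ∃ g ∈ stab G c, g • y ∈ U := by
  constructor
  · rintro ⟨g, hg, a, ha, rfl⟩
    exact ⟨g⁻¹, inv_mem_stab hg, by simpa using ha⟩
  · rintro ⟨g, hg, ha⟩
    exact ⟨g⁻¹, inv_mem_stab hg, g • y, ha, by simp⟩

theorem partialOrbit_empty (x : X) :
    partialOrbit G x (FinPart.empty G) = MulAction.orbit G x := by
  ext y
  simp [partialOrbit, V, FinPart.empty, MulAction.mem_orbit_iff]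

/-! ### The first level -/

section Base

variable [TopologicalSpace X] {A : ℕ → Set X}

/-- The first level compares the open sets that meet `V_σ x` and `V_c y`, that is, the closures of
these two sets. In particular it does not depend on the basis. -/
theorem mem_baseSet_iff (hA : TopologicalSpace.IsTopologicalBasis (Set.range A)) {x y : X}
    {σ : FinPart G} : y ∈ baseSet G A x σ ↔
      ∀ U : Set X, IsOpen U →
        ((∃ f ∈ V G σ, f • x ∈ U) ↔ ∃ g ∈ stab G σ.rng, g • y ∈ U) := by
  have hne : ∀ U : Set X, (partialOrbit G x σ ∩ U).Nonempty ↔ ∃ f ∈ V G σ, f • x ∈ U := by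
    intro U
    constructor
    · rintro ⟨_, ⟨f, hf, rfl⟩, hU⟩
      exact ⟨f, hf, hU⟩
    · rintro ⟨f, hf, hU⟩
      exact ⟨_, ⟨f, hf, rfl⟩, hU⟩
  simp only [baseSet, Set.mem_inter_iff, Set.mem_iInter, Set.mem_compl_iff,
    ← Set.not_nonempty_iff_eq_empty, hne, mem_stab_smul]
  constructor
  · rintro ⟨h1, h2⟩ U hU
    constructor
    · rintro ⟨f, hf, hfU⟩
      obtain ⟨_, ⟨l, rfl⟩, hl, hlU⟩ := hA.exists_subset_of_mem_open hfU hU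
      obtain ⟨g, hg, hgl⟩ := h1 l ⟨f, hf, hl⟩
      exact ⟨g, hg, hlU hgl⟩
    · rintro ⟨g, hg, hgU⟩
      obtain ⟨_, ⟨l, rfl⟩, hl, hlU⟩ := hA.exists_subset_of_mem_open hgU hU
      by_contra hcon
      refine h2 l ?_ ⟨g, hg, hl⟩
      rintro ⟨f, hf, hfl⟩
      exact hcon ⟨f, hf, hlU hfl⟩
  · intro h
    have hl : ∀ l, IsOpen (A l) := fun l => hA.isOpen ⟨l, rfl⟩
    exact ⟨fun l => (h _ (hl l)).1, fun l hn hg => hn ((h _ (hl l)).2 hg)⟩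

theorem smul_mem_baseSet [ContinuousSMul G X]
    (hA : TopologicalSpace.IsTopologicalBasis (Set.range A)) {x y : X} {σ : FinPart G} (h : G)
    (hy : y ∈ baseSet G A x σ) : h • y ∈ baseSet G A x (translate h σ) := by
  rw [mem_baseSet_iff hA] at hy ⊢
  intro U hU
  have := hy _ (hU.preimage (continuous_const_smul h))
  rw [rng_translate]
  constructor
  · rintro ⟨f, hf, hfU⟩
    have hf' : h⁻¹ * f ∈ V G σ := by
      simpa [translate_inv_translate] using mul_mem_V_translate h⁻¹ hf
    obtain ⟨g, hg, hgU⟩ := this.1 ⟨_, hf', by simpa [smul_smul] using hfU⟩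
    exact ⟨_, conj_mem_stab h hg, by simpa [smul_smul] using hgU⟩
  · rintro ⟨g, hg, hgU⟩
    have hg' : h⁻¹ * g * h ∈ stab G σ.rng := by
      have := conj_mem_stab h⁻¹ hg
      simpa [Finset.image_image, Function.comp_def] using this
    obtain ⟨f, hf, hfU⟩ := this.2 ⟨_, hg', by simpa [smul_smul, mul_assoc] using hgU⟩
    exact ⟨_, mul_mem_V_translate h hf, by simpa [smul_smul] using hfU⟩

end Base

/-! ### Levels of the hierarchy -/

/-- Induction along the recursion that defines the sets `B_α(x, σ)`, which starts at `1`. -/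
theorem pos_ordinal_induction {p : Ordinal.{0} → Prop} (one : p 1)
    (add_one : ∀ α, 0 < α → p α → p (α + 1))
    (limit : ∀ o, Order.IsSuccLimit o → (∀ β < o, 0 < β → p β) → p o) :
    ∀ α, 0 < α → p α := by
  intro α
  induction α using Ordinal.limitRecOn with
  | zero => exact fun h => absurd h (lt_irrefl _)
  | add_one β ih =>
    intro _
    rcases eq_or_ne β 0 with rfl | hβ
    · simpa using one
    · exact add_one β (pos_iff_ne_zero.2 hβ) (ih (pos_iff_ne_zero.2 hβ))
  | limit o ho ih => exact fun _ => limit o ho ih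

theorem mem_alphaSet_limit {A : ℕ → Set X} {x y : X} {o : Ordinal.{0}}
    (ho : Order.IsSuccLimit o) {σ : FinPart G} :
    y ∈ alphaSet G A x o σ ↔ ∀ β < o, 0 < β → y ∈ alphaSet G A x β σ := by
  simp [alphaSet_limit _ _ _ _ ho]

theorem alphaSet_add_one_subset {A : ℕ → Set X} {x : X} {α : Ordinal.{0}} (hα : 0 < α)
    (σ : FinPart G) : alphaSet G A x (α + 1) σ ⊆ alphaSet G A x α σ := by
  intro y hy
  rw [alphaSet_add_one _ _ _ _ hα, mem_stepSet_iff] at hy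
  obtain ⟨τ, hστ, hd, hτ⟩ := hy.1 σ.dom subset_rfl
  rwa [hστ.eq_of_dom_eq hd] at hτ

theorem alphaSet_anti {A : ℕ → Set X} {x : X} {α β : Ordinal.{0}} (hα : 0 < α) (hαβ : α ≤ β)
    (σ : FinPart G) : alphaSet G A x β σ ⊆ alphaSet G A x α σ := by
  refine pos_ordinal_induction (p := fun β => α ≤ β → alphaSet G A x β σ ⊆ alphaSet G A x α σ)
    ?_ ?_ ?_ β (hα.trans_le hαβ) hαβ
  · intro h
    rw [le_antisymm h (Order.one_le_iff_pos.2 hα)]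
  · intro β hβ ih h
    rcases h.eq_or_lt with rfl | h
    · exact subset_rfl
    · exact (alphaSet_add_one_subset hβ σ).trans (ih (Order.lt_add_one_iff.1 h))
  · intro o ho _ h y hy
    rcases h.eq_or_lt with rfl | h
    · exact hy
    · exact (mem_alphaSet_limit ho).1 hy α h hα

section Topology

variable [TopologicalSpace X] {A : ℕ → Set X}

theorem smul_mem_alphaSet [ContinuousSMul G X]
    (hA : TopologicalSpace.IsTopologicalBasis (Set.range A)) {x : X} {α : Ordinal.{0}}
    (hα : 0 < α) {y : X} {σ : FinPart G} (h : G) (hy : y ∈ alphaSet G A x α σ) :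
    h • y ∈ alphaSet G A x α (translate h σ) := by
  refine pos_ordinal_induction (p := fun α => ∀ σ : FinPart G, y ∈ alphaSet G A x α σ →
    h • y ∈ alphaSet G A x α (translate h σ)) ?_ ?_ ?_ α hα σ hy
  · intro σ hy
    rw [alphaSet_one] at hy ⊢
    exact smul_mem_baseSet hA h hy
  · intro α hα ih σ hy
    rw [alphaSet_add_one _ _ _ _ hα, mem_stepSet_iff] at hy ⊢
    constructor
    · intro b hb
      obtain ⟨τ, hστ, hd, hτ⟩ := hy.1 b (by rwa [dom_translate] at hb)
      exact ⟨translate h τ, hστ.translate h, by rw [dom_translate, hd], ih τ hτ⟩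
    · intro a ha
      rw [rng_translate] at ha
      obtain ⟨τ, hστ, hr, hτ⟩ := hy.2 (a.image (h⁻¹ : Equiv.Perm ℕ)) (by
        simpa [Finset.image_image, Function.comp_def] using
          Finset.image_subset_image (f := ((h⁻¹ : Equiv.Perm ℕ) : ℕ → ℕ)) ha)
      exact ⟨translate h τ, hστ.translate h, by
        simp [rng_translate, hr, Finset.image_image, Function.comp_def], ih τ hτ⟩
  · intro o ho ih σ hy
    rw [mem_alphaSet_limit ho] at hy ⊢
    exact fun β hβ h0 => ih β hβ h0 σ (hy β hβ h0)

theorem partialOrbit_subset_alphaSet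
    (hA : TopologicalSpace.IsTopologicalBasis (Set.range A)) {x : X} {α : Ordinal.{0}}
    (hα : 0 < α) (σ : FinPart G) : partialOrbit G x σ ⊆ alphaSet G A x α σ := by
  rintro _ ⟨f, hf, rfl⟩
  refine pos_ordinal_induction
    (p := fun α => ∀ σ : FinPart G, f ∈ V G σ → f • x ∈ alphaSet G A x α σ) ?_ ?_ ?_ α hα σ hf
  · intro σ hf
    rw [alphaSet_one, mem_baseSet_iff hA]
    intro U _
    constructor
    · rintro ⟨g, hg, hgU⟩
      exact ⟨_, mul_inv_mem_stab hf hg, by simpa [smul_smul] using hgU⟩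
    · rintro ⟨g, hg, hgU⟩
      exact ⟨_, mul_mem_V hf hg, by simpa [smul_smul] using hgU⟩
  · intro α hα ih σ hf
    rw [alphaSet_add_one _ _ _ _ hα, mem_stepSet_iff]
    constructor
    · intro b hb
      exact ⟨restrict f b,
        ext_of_mem_V hf (mem_V_restrict f b) (by rwa [dom_restrict]),
        dom_restrict f b, ih _ (mem_V_restrict f b)⟩
    · intro a ha
      let b : Finset ℕ := a.image (f⁻¹ : Equiv.Perm ℕ)
      refine ⟨restrict f b, ext_of_mem_V hf (mem_V_restrict f b) ?_,
        ?_, ih _ (mem_V_restrict f b)⟩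
      · rw [dom_restrict]
        rw [rng_eq_image hf] at ha
        simpa [b, Finset.image_image, Function.comp_def] using
          Finset.image_subset_image (f := ((f⁻¹ : Equiv.Perm ℕ) : ℕ → ℕ)) ha
      · simp [rng_restrict, b, Finset.image_image, Function.comp_def]
  · intro o ho ih σ hf
    rw [mem_alphaSet_limit ho]
    exact fun β hβ h0 => ih β hβ h0 σ hf

theorem alphaSet_nonempty (hA : TopologicalSpace.IsTopologicalBasis (Set.range A)) (x : X)
    {α : Ordinal.{0}} (hα : 0 < α) (σ : FinPart G) : (alphaSet G A x α σ).Nonempty := by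
  obtain ⟨f, hf⟩ := V_nonempty σ
  exact ⟨f • x, partialOrbit_subset_alphaSet hA hα σ ⟨f, hf, rfl⟩⟩

/-- The sets `B_α(x, σ)` with a fixed range of `σ` are classes of an equivalence relation: two that
meet coincide. -/
theorem alphaSet_subset_of_mem [ContinuousSMul G X]
    (hA : TopologicalSpace.IsTopologicalBasis (Set.range A)) {x : X} {α : Ordinal.{0}}
    (hα : 0 < α) {σ δ : FinPart G} (hr : σ.rng = δ.rng) {y : X} (hσ : y ∈ alphaSet G A x α σ)
    (hδ : y ∈ alphaSet G A x α δ) : alphaSet G A x α σ ⊆ alphaSet G A x α δ := by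
  refine pos_ordinal_induction (p := fun α => ∀ (σ δ : FinPart G) (y : X), σ.rng = δ.rng →
    y ∈ alphaSet G A x α σ → y ∈ alphaSet G A x α δ → alphaSet G A x α σ ⊆ alphaSet G A x α δ)
    ?_ ?_ ?_ α hα σ δ y hr hσ hδ
  · intro σ δ y hr hσ hδ z hz
    rw [alphaSet_one, mem_baseSet_iff hA] at *
    intro U hU
    rw [hδ U hU, ← hr, ← hσ U hU, hz U hU]
  · intro α hα ih σ δ y hr hσ hδ z hz
    rw [alphaSet_add_one _ _ _ _ hα, mem_stepSet_iff] at *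
    constructor
    · intro b hb
      -- A part `δ'` that works for `y` is carried to one for `z` by the translation between the
      -- parts `σ'` and `σ''` above `σ` that belong to `y` and `z`.
      obtain ⟨δ', hδ', hb', hyδ⟩ := hδ.1 b hb
      obtain ⟨σ', hσ', ha', hyσ⟩ := hσ.2 δ'.rng (hr ▸ hδ'.rng_subset)
      obtain ⟨σ'', hσ'', hd'', hzσ⟩ := hz.1 σ'.dom hσ'.dom_subset
      obtain ⟨h, rfl, hst⟩ := exists_translate_eq hd''.symm
      have hz' : h⁻¹ • z ∈ alphaSet G A x α σ' := by
        simpa [translate_inv_translate] using smul_mem_alphaSet hA hα h⁻¹ hzσ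
      have := smul_mem_alphaSet hA hα h (ih _ _ _ ha' hyσ hyδ hz')
      refine ⟨translate h δ', ?_, by rw [dom_translate, hb'], by simpa using this⟩
      have hst' := hst σ hσ' hσ''
      rw [hr] at hst'
      have := hδ'.translate h
      rwa [translate_eq_self hst'] at this
    · intro a ha
      obtain ⟨σ', hσ', ha', hzσ⟩ := hz.2 a (hr ▸ ha)
      obtain ⟨σ'', hσ'', hd'', hyσ⟩ := hσ.1 σ'.dom hσ'.dom_subset
      obtain ⟨h, rfl, hst⟩ := exists_translate_eq hd''.symm
      obtain ⟨δ', hδ', hb', hyδ⟩ := hδ.2 (translate h σ').rng (hr ▸ hσ''.rng_subset)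
      have hz' : h⁻¹ • h • z ∈ alphaSet G A x α (translate h⁻¹ δ') :=
        smul_mem_alphaSet hA hα h⁻¹ (ih _ _ _ hb'.symm hyσ hyδ (smul_mem_alphaSet hA hα h hzσ))
      refine ⟨translate h⁻¹ δ', ?_, ?_, by simpa using hz'⟩
      · have hst' := inv_mem_stab (hst σ hσ' hσ'')
        rw [hr] at hst'
        have := hδ'.translate h⁻¹
        rwa [translate_eq_self hst'] at this
      · rw [rng_translate, hb', ← rng_translate, translate_inv_translate, ha']
  · intro o ho ih σ δ y hr hσ hδ z hz
    rw [mem_alphaSet_limit ho] at *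
    exact fun β hβ h0 => ih β hβ h0 σ δ y hr (hσ β hβ h0) (hδ β hβ h0) (hz β hβ h0)

theorem alphaSet_eq_of_mem [ContinuousSMul G X]
    (hA : TopologicalSpace.IsTopologicalBasis (Set.range A)) {x : X} {α : Ordinal.{0}}
    (hα : 0 < α) {σ δ : FinPart G} (hr : σ.rng = δ.rng) {y : X} (hσ : y ∈ alphaSet G A x α σ)
    (hδ : y ∈ alphaSet G A x α δ) : alphaSet G A x α σ = alphaSet G A x α δ :=
  (alphaSet_subset_of_mem hA hα hr hσ hδ).antisymm (alphaSet_subset_of_mem hA hα hr.symm hδ hσ)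

/-! ### Existence of a separating level -/

theorem alphaSet_eq_of_le [ContinuousSMul G X]
    (hA : TopologicalSpace.IsTopologicalBasis (Set.range A)) {x : X} {α β : Ordinal.{0}}
    (hα : 0 < α) (hαβ : α ≤ β) {σ δ : FinPart G} (hr : σ.rng = δ.rng)
    (h : alphaSet G A x β σ = alphaSet G A x β δ) :
    alphaSet G A x α σ = alphaSet G A x α δ := by
  obtain ⟨y, hy⟩ := alphaSet_nonempty hA x (hα.trans_le hαβ) σ
  exact alphaSet_eq_of_mem hA hα hr (alphaSet_anti hα hαβ σ hy) (alphaSet_anti hα hαβ δ (h ▸ hy))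

theorem separatingLevels_nonempty [ContinuousSMul G X]
    (hA : TopologicalSpace.IsTopologicalBasis (Set.range A)) (x : X) :
    (separatingLevels G A x).Nonempty := by
  have hex : ∀ q : FinPart G × FinPart G, ∃ β : Ordinal.{0}, 0 < β ∧ β < ω₁ ∧
      ((∃ α : Ordinal.{0}, 0 < α ∧ α < ω₁ ∧ alphaSet G A x α q.1 ≠ alphaSet G A x α q.2) →
        alphaSet G A x β q.1 ≠ alphaSet G A x β q.2) := by
    intro q
    by_cases h : ∃ α : Ordinal.{0}, 0 < α ∧ α < ω₁ ∧
        alphaSet G A x α q.1 ≠ alphaSet G A x α q.2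
    · obtain ⟨α, h0, h1, hne⟩ := h
      exact ⟨α, h0, h1, fun _ => hne⟩
    · exact ⟨1, zero_lt_one, Ordinal.one_lt_omega0.trans Ordinal.omega0_lt_omega_one,
        fun h' => absurd h' h⟩
  choose β h0 h1 hne using hex
  have hle : ∀ q, β q ≤ ⨆ q, β q := Ordinal.le_iSup β
  refine ⟨⨆ q, β q, (h0 (FinPart.empty G, FinPart.empty G)).trans_le (hle _),
    Ordinal.iSup_lt_omega_one h1, fun σ δ hr hα heq => ?_⟩
  exact hne (σ, δ) hα (alphaSet_eq_of_le hA (h0 _) (hle _) hr heq)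

/-! ### The orbit at the second level above a separating one -/

/-- For a point `y` of `B_{γ+2}(x, σ)`, membership in the sets `B_γ(x, τ)` with `τ ⊇ σ` passes from the
level `γ` to the level `γ + 1`. This is where both extra levels above `γ` are used. -/
theorem mem_alphaSet_add_one_of_mem [ContinuousSMul G X]
    (hA : TopologicalSpace.IsTopologicalBasis (Set.range A)) {x y : X} {γ : Ordinal.{0}}
    (hγ : γ ∈ separatingLevels G A x) {σ τ : FinPart G}
    (hy : y ∈ alphaSet G A x (γ + 1 + 1) σ) (hστ : σ.Ext τ) (hτ : y ∈ alphaSet G A x γ τ) :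
    y ∈ alphaSet G A x (γ + 1) τ := by
  obtain ⟨h0, h1, hsep⟩ := hγ
  have h0' : 0 < γ + 1 := h0.trans (Order.lt_add_one_iff.2 le_rfl)
  have h1' : γ + 1 < ω₁ := by
    rw [← Cardinal.ord_aleph] at h1 ⊢
    exact (Cardinal.isSuccLimit_ord (Cardinal.aleph0_le_aleph 1)).add_one_lt h1
  rw [alphaSet_add_one _ _ _ _ h0', mem_stepSet_iff] at hy
  obtain ⟨δ, -, hr, hδ⟩ := hy.2 τ.rng hστ.rng_subset
  have heq := alphaSet_eq_of_mem hA h0 hr.symm hτ (alphaSet_add_one_subset h0 δ hδ)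
  by_contra hcon
  exact hsep τ δ hr.symm ⟨γ + 1, h0', h1', fun h => hcon (h ▸ hδ)⟩ heq

theorem smul_eq_of_chain [T2Space X] [ContinuousSMul G X]
    (hA : TopologicalSpace.IsTopologicalBasis (Set.range A)) {x y : X} {s : ℕ → FinPart G}
    (hs : ∀ n, (s n).Ext (s (n + 1))) (hd : ∀ n, n ∈ (s (n + 1)).dom) {f : G}
    (hf : ∀ n, f ∈ V G (s n)) (hy : ∀ n, y ∈ baseSet G A x (s n)) : f • x = y := by
  -- Otherwise `V_τ x`, for `τ` far along the chain, misses a neighbourhood of `y`.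
  by_contra hne
  obtain ⟨U, W, hU, hW, hxU, hyW, hUW⟩ := t2_separation hne
  have hex : ∀ n, ∃ g ∈ V G (s n), g • x ∈ W := fun n =>
    ((mem_baseSet_iff hA).1 (hy n) W hW).2 ⟨1, one_mem_stab _, by simpa using hyW⟩
  choose g hg hgW using hex
  have hlim : Tendsto g atTop (𝓝 f) :=
    tendsto_subtype_rng.2 (tendsto_perm_of_chain hs hd hg hf)
  obtain ⟨n, hn⟩ := ((hlim.smul_const x).eventually (hU.mem_nhds hxU)).exists
  exact Set.disjoint_left.1 hUW hn (hgW n)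

theorem alphaSet_add_two_eq_partialOrbit [T2Space X] [ContinuousSMul G X]
    (hG : IsClosed (G : Set (Equiv.Perm ℕ)))
    (hA : TopologicalSpace.IsTopologicalBasis (Set.range A)) {x : X} {γ : Ordinal.{0}}
    (hγ : γ ∈ separatingLevels G A x) (σ : FinPart G) :
    alphaSet G A x (γ + 2) σ = partialOrbit G x σ := by
  have h0 : 0 < γ := hγ.1
  have h0' : 0 < γ + 1 := h0.trans (Order.lt_add_one_iff.2 le_rfl)
  have h0'' : 0 < γ + 1 + 1 := h0'.trans (Order.lt_add_one_iff.2 le_rfl)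
  rw [← one_add_one_eq_two, ← add_assoc]
  refine Set.Subset.antisymm (fun y hy => ?_) (partialOrbit_subset_alphaSet hA h0'' σ)
  have hstep : ∀ (n : ℕ) (τ : {τ : FinPart G // σ.Ext τ ∧ y ∈ alphaSet G A x (γ + 1) τ}),
      ∃ τ' : {τ : FinPart G // σ.Ext τ ∧ y ∈ alphaSet G A x (γ + 1) τ},
        τ.1.Ext τ'.1 ∧ n ∈ τ'.1.dom ∧ n ∈ τ'.1.rng := by
    rintro n ⟨τ, hστ, hτ⟩
    rw [alphaSet_add_one _ _ _ _ h0, mem_stepSet_iff] at hτ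
    obtain ⟨ρ, hτρ, hd, hρ⟩ := hτ.1 (insert n τ.dom) (Finset.subset_insert _ _)
    have hρ' := mem_alphaSet_add_one_of_mem hA hγ hy (hστ.trans hτρ) hρ
    rw [alphaSet_add_one _ _ _ _ h0, mem_stepSet_iff] at hρ'
    obtain ⟨π, hρπ, hr, hπ⟩ := hρ'.2 (insert n ρ.rng) (Finset.subset_insert _ _)
    have hσπ := (hστ.trans hτρ).trans hρπ
    refine ⟨⟨π, hσπ, mem_alphaSet_add_one_of_mem hA hγ hy hσπ hπ⟩, hτρ.trans hρπ, ?_, ?_⟩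
    · exact hρπ.dom_subset (hd ▸ Finset.mem_insert_self _ _)
    · exact hr ▸ Finset.mem_insert_self _ _
  choose next hext hdom hrng using hstep
  let s : ℕ → {τ : FinPart G // σ.Ext τ ∧ y ∈ alphaSet G A x (γ + 1) τ} := fun n =>
    Nat.rec ⟨σ, Ext.refl σ, alphaSet_add_one_subset h0' σ hy⟩ next n
  have hs : ∀ n, (s n).1.Ext (s (n + 1)).1 := fun n => hext n (s n)
  have hd : ∀ n, n ∈ (s (n + 1)).1.dom := fun n => hdom n (s n)
  have hr : ∀ n, n ∈ (s (n + 1)).1.rng := fun n => hrng n (s n)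
  obtain ⟨f, hf⟩ := exists_mem_V_of_chain hG hs hd hr
  refine ⟨f, hf 0, smul_eq_of_chain hA hs hd hf fun n => ?_⟩
  rw [← alphaSet_one]
  exact alphaSet_anti zero_lt_one (Order.one_le_iff_pos.2 h0') _ (s n).2.2

end Topology

end AlphaSets

theorem theorem23 {X : Type*} [TopologicalSpace X] [PolishSpace X]
    (G : Subgroup (Equiv.Perm ℕ)) (hG : IsClosed (G : Set (Equiv.Perm ℕ)))
    [MulAction G X] [ContinuousSMul G X]
    (A : ℕ → Set X) (hA : TopologicalSpace.IsTopologicalBasis (Set.range A)) (x : X) :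
    IsLeast (AlphaSets.separatingLevels G A x) (AlphaSets.gammaStar G A x) ∧
    AlphaSets.alphaSet G A x (AlphaSets.gammaStar G A x + 2) (AlphaSets.FinPart.empty G) =
      MulAction.orbit G x ∧
    ∀ σ : AlphaSets.FinPart G,
      AlphaSets.alphaSet G A x (AlphaSets.gammaStar G A x + 2) σ =
        AlphaSets.partialOrbit G x σ := by
  have hγ : AlphaSets.gammaStar G A x ∈ AlphaSets.separatingLevels G A x :=
    csInf_mem (AlphaSets.separatingLevels_nonempty hA x)
  refine ⟨⟨hγ, fun β hβ => csInf_le' hβ⟩, ?_,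
    AlphaSets.alphaSet_add_two_eq_partialOrbit hG hA hγ⟩
  rw [AlphaSets.alphaSet_add_two_eq_partialOrbit hG hA hγ, AlphaSets.partialOrbit_empty]
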